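/- Let $\gamma$ be a $C^2$ closed plane curve, that is, let $\gamma:\mathbb{R}\to\mathbb{R}^2$ be a $C^2$ map, periodic with some period $L>0$, with $\gamma'(t)\neq 0$ for all $t$; self-intersections are allowed. For each $t$, the normal line to $\gamma$ at $t$ is the line through $\gamma(t)$ orthogonal to $\gamma'(t)$. Then $\gamma$ has at least one tripod configuration: there are three normal lines $\ell_1,\ell_2,\ell_3$ of $\gamma$ that pass through a common point $p$ and together form three angles of $2\pi/3$ there, that is, there are nonzero vectors $u_1,u_2,u_3$, with $u_i$ parallel to $\ell_i$, that pairwise make the angle $2\pi/3$. -/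

import Mathlib

/-- The Euclidean plane. -/
abbrev Plane : Type := EuclideanSpace ℝ (Fin 2)

/-- `γ` is a regular (immersed) `C²` closed plane curve, presented as an `L`-periodic map of the
line. It need not be injective on a period, so self-intersections are allowed. -/
structure IsC2ClosedCurve (γ : ℝ → Plane) (L : ℝ) : Prop where
  period_pos : 0 < L
  periodic : Function.Periodic γ L
  contDiff : ContDiff ℝ 2 γ
  deriv_ne_zero : ∀ t, deriv γ t ≠ 0

/-- The normal line to `γ` at the parameter `t`: the line through `γ t` orthogonal to `γ' t`. -/
noncomputable def normalLine (γ : ℝ → Plane) (t : ℝ) : AffineSubspace ℝ Plane :=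
  AffineSubspace.mk' (γ t) (Submodule.span ℝ {deriv γ t})ᗮ

/-- The lines `ℓ 0`, `ℓ 1`, `ℓ 2` form a tripod configuration of `γ` with tripod point `p`:
each of them is normal to `γ`, they all pass through `p`, and suitable direction vectors of them
make pairwise angles `2π/3`, that is, rays from `p` along the three lines cut the plane into three
angles of `2π/3`. -/
def IsTripodConfiguration (γ : ℝ → Plane) (ℓ : Fin 3 → AffineSubspace ℝ Plane) (p : Plane) :
    Prop :=
  (∀ i, ∃ t, ℓ i = normalLine γ t) ∧
  (∀ i, p ∈ ℓ i) ∧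
  ∃ u : Fin 3 → Plane, (∀ i, u i ∈ (ℓ i).direction) ∧
    ∀ i j, i ≠ j → InnerProductGeometry.angle (u i) (u j) = 2 * Real.pi / 3

/-! Take an equilateral triangle of largest altitude circumscribed about the curve: maximise
`tripodHeight` jointly over the contact parameters and the angle. Criticality in each `t i` makes
leg `i` orthogonal to the curve, hence parallel to the normal there. Criticality in `θ` makes the
components of the contact points orthogonal to the legs sum to zero, which is exactly the condition
for the three normals to concur. -/

open Real in
/-- The unit vector at the angle `φ` from the first coordinate axis. -/
noncomputable def unitVec (φ : ℝ) : Plane := !₂[cos φ, sin φ]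

open Real in
/-- The unit vector at the angle `φ + π / 2`. -/
noncomputable def unitVecRot (φ : ℝ) : Plane := !₂[-sin φ, cos φ]

/-- The angles of the three legs of a tripod whose first leg is at the angle `θ`. -/
noncomputable def legAngle (θ : ℝ) (i : Fin 3) : ℝ := θ + (i : ℕ) * (2 * Real.pi / 3)

/-- The sum of the signed distances from the origin to the lines through the points `γ (t i)`
that are orthogonal to the legs of the tripod at `θ`. -/
noncomputable def tripodHeight (γ : ℝ → Plane) (t : Fin 3 → ℝ) (θ : ℝ) : ℝ :=
  ∑ i, inner ℝ (unitVec (legAngle θ i)) (γ (t i))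

theorem inner_plane (v w : Plane) : inner ℝ v w = v 0 * w 0 + v 1 * w 1 := by
  simp [PiLp.inner_apply, Fin.sum_univ_two, mul_comm]

theorem inner_unitVec (φ ψ : ℝ) : inner ℝ (unitVec φ) (unitVec ψ) = Real.cos (φ - ψ) := by
  simp [inner_plane, unitVec, Real.cos_sub]

theorem inner_unitVecRot (φ ψ : ℝ) :
    inner ℝ (unitVecRot φ) (unitVecRot ψ) = Real.cos (φ - ψ) := by
  simp [inner_plane, unitVecRot, Real.cos_sub]; ring

theorem norm_unitVec (φ : ℝ) : ‖unitVec φ‖ = 1 := by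
  have h := inner_unitVec φ φ
  rw [real_inner_self_eq_norm_sq, sub_self, Real.cos_zero] at h
  exact (pow_eq_one_iff_of_nonneg (norm_nonneg _) two_ne_zero).1 h

/-- A vector orthogonal to `unitVec φ` is a multiple of `unitVecRot φ`. -/
theorem eq_smul_unitVecRot {φ : ℝ} {v : Plane} (h : inner ℝ (unitVec φ) v = 0) :
    v = inner ℝ (unitVecRot φ) v • unitVecRot φ := by
  simp only [inner_plane, unitVec, unitVecRot] at h ⊢
  have hs := Real.sin_sq_add_cos_sq φ
  ext i
  fin_cases i <;> simp at h ⊢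
  · linear_combination (-v 0) * hs + Real.cos φ * h
  · linear_combination (-v 1) * hs + Real.sin φ * h

theorem cos_two_pi_div_three : Real.cos (2 * Real.pi / 3) = -1 / 2 := by
  rw [show 2 * Real.pi / 3 = Real.pi - Real.pi / 3 by ring, Real.cos_pi_sub,
    Real.cos_pi_div_three]
  norm_num

theorem cos_four_pi_div_three : Real.cos (4 * Real.pi / 3) = -1 / 2 := by
  rw [show 4 * Real.pi / 3 = Real.pi / 3 + Real.pi by ring, Real.cos_add_pi,
    Real.cos_pi_div_three]
  norm_num

theorem cos_legAngle_sub (θ : ℝ) {i j : Fin 3} (h : i ≠ j) :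
    Real.cos (legAngle θ i - legAngle θ j) = -1 / 2 := by
  wlog hij : j < i generalizing i j
  · rw [← Real.cos_neg, neg_sub]
    exact this h.symm (lt_of_le_of_ne (not_lt.1 hij) h)
  have key : legAngle θ i - legAngle θ j = 2 * Real.pi / 3 ∨
      legAngle θ i - legAngle θ j = 4 * Real.pi / 3 := by
    fin_cases i <;> fin_cases j <;> simp only [legAngle] <;> revert hij <;> simp
    · ring
    · exact Or.inl (by ring)
  rcases key with h | h <;> rw [h]
  exacts [cos_two_pi_div_three, cos_four_pi_div_three]

theorem angle_unitVec_legAngle (θ : ℝ) {i j : Fin 3} (h : i ≠ j) :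
    InnerProductGeometry.angle (unitVec (legAngle θ i)) (unitVec (legAngle θ j)) =
      2 * Real.pi / 3 := by
  rw [InnerProductGeometry.angle, inner_unitVec, norm_unitVec, norm_unitVec,
    cos_legAngle_sub θ h, mul_one, div_one, ← cos_two_pi_div_three]
  exact Real.arccos_cos (by positivity) (by linarith [Real.pi_pos])

/-- Prescribed components along the three directions orthogonal to the legs are those of some
point as soon as they sum to zero. -/
theorem exists_inner_unitVecRot_eq (θ : ℝ) (a : Fin 3 → ℝ) (ha : ∑ i, a i = 0) :
    ∃ p : Plane, ∀ i, inner ℝ (unitVecRot (legAngle θ i)) p = a i := by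
  -- The Gram matrix of the three vectors is `3/2` times the identity minus `1/2` times the all-ones
  -- matrix, and the latter kills `a`; hence the factor `2/3`.
  refine ⟨(2 / 3 : ℝ) • ∑ j, a j • unitVecRot (legAngle θ j), fun i => ?_⟩
  have hself : ∀ j, inner ℝ (unitVecRot (legAngle θ j)) (unitVecRot (legAngle θ j)) = (1 : ℝ) :=
    fun j => by rw [inner_unitVecRot, sub_self, Real.cos_zero]
  have hne : ∀ j k, j ≠ k →
      inner ℝ (unitVecRot (legAngle θ j)) (unitVecRot (legAngle θ k)) = (-1 / 2 : ℝ) :=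
    fun j k h => by rw [inner_unitVecRot, cos_legAngle_sub θ h]
  rw [Fin.sum_univ_three] at ha
  simp only [inner_smul_right, inner_add_right, Fin.sum_univ_three]
  fin_cases i
  · simp only [Fin.zero_eta, hself, hne 0 1 (by decide), hne 0 2 (by decide)]
    linarith
  · simp only [Fin.mk_one, hself, hne 1 0 (by decide), hne 1 2 (by decide)]
    linarith
  · simp only [Fin.reduceFinMk, hself, hne 2 0 (by decide), hne 2 1 (by decide)]
    linarith

theorem hasDerivAt_unitVec (φ : ℝ) : HasDerivAt unitVec (unitVecRot φ) φ := by
  have h : HasDerivAt (fun φ => ![Real.cos φ, Real.sin φ]) ![-Real.sin φ, Real.cos φ] φ := by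
    refine hasDerivAt_pi.2 fun i => ?_
    fin_cases i
    · simpa using Real.hasDerivAt_cos φ
    · simpa using Real.hasDerivAt_sin φ
  exact (PiLp.hasFDerivAt_toLp (𝕜 := ℝ) 2 _).comp_hasDerivAt φ h

theorem continuous_unitVec : Continuous unitVec :=
  continuous_iff_continuousAt.2 fun φ => (hasDerivAt_unitVec φ).continuousAt

theorem unitVec_periodic : Function.Periodic unitVec (2 * Real.pi) := fun φ => by
  simp [unitVec]

theorem tripodHeight_periodic (γ : ℝ → Plane) (t : Fin 3 → ℝ) :
    Function.Periodic (tripodHeight γ t) (2 * Real.pi) := fun θ => by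
  simp only [tripodHeight]
  refine Finset.sum_congr rfl fun i _ => ?_
  rw [show legAngle (θ + 2 * Real.pi) i = legAngle θ i + 2 * Real.pi by
    simp only [legAngle]; ring, unitVec_periodic]

/-- Periodicity in every variable reduces the search to a compact box. -/
theorem exists_forall_tripodHeight_le {γ : ℝ → Plane} {L : ℝ} (hL : 0 < L)
    (hper : Function.Periodic γ L) (hcont : Continuous γ) :
    ∃ t θ, ∀ t' θ', tripodHeight γ t' θ' ≤ tripodHeight γ t θ := by
  let K : Set ((Fin 3 → ℝ) × ℝ) :=
    (Set.univ.pi fun _ => Set.Icc 0 L) ×ˢ Set.Icc 0 (2 * Real.pi)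
  have hK : IsCompact K := (isCompact_univ_pi fun _ => isCompact_Icc).prod isCompact_Icc
  have hne : K.Nonempty :=
    ⟨(0, 0), fun _ _ => ⟨le_rfl, hL.le⟩, le_rfl, Real.two_pi_pos.le⟩
  have hF : Continuous fun x : (Fin 3 → ℝ) × ℝ => tripodHeight γ x.1 x.2 := by
    refine continuous_finsetSum _ fun i _ => Continuous.inner ?_ ?_
    · refine continuous_unitVec.comp ?_
      simp only [legAngle]
      fun_prop
    · fun_prop
  obtain ⟨⟨t, θ⟩, -, hmax⟩ := hK.exists_isMaxOn hne hF.continuousOn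
  refine ⟨t, θ, fun t' θ' => ?_⟩
  choose s hs using fun i => hper.exists_mem_Ico₀ hL (t' i)
  obtain ⟨η, hη, hη'⟩ := (tripodHeight_periodic γ t').exists_mem_Ico₀ Real.two_pi_pos θ'
  have hst : tripodHeight γ t' η = tripodHeight γ s η := by
    simp only [tripodHeight, (hs _).2]
  rw [hη', hst]
  exact hmax (a := (s, η))
    ⟨fun i _ => Set.Ico_subset_Icc_self (hs i).1, Set.Ico_subset_Icc_self hη⟩

theorem inner_deriv_eq_zero_of_forall_le {γ : ℝ → Plane} (hd : Differentiable ℝ γ)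
    {t : Fin 3 → ℝ} {θ : ℝ} (hmax : ∀ t', tripodHeight γ t' θ ≤ tripodHeight γ t θ) (i : Fin 3) :
    inner ℝ (unitVec (legAngle θ i)) (deriv γ (t i)) = 0 := by
  have hder : HasDerivAt (fun s => inner ℝ (unitVec (legAngle θ i)) (γ s))
      (inner ℝ (unitVec (legAngle θ i)) (deriv γ (t i))) (t i) := by
    simpa using (hasDerivAt_const (t i) (unitVec (legAngle θ i))).inner ℝ
      (hd (t i)).hasDerivAt
  refine IsLocalMax.hasDerivAt_eq_zero (Filter.Eventually.of_forall fun s => ?_) hder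
  -- Moving only the `i`-th contact point leaves the other two summands fixed.
  have h := hmax (Function.update t i s)
  simp only [tripodHeight] at h
  rw [← Finset.add_sum_erase _ _ (Finset.mem_univ i),
    ← Finset.add_sum_erase (a := i) _ (fun j => inner ℝ (unitVec (legAngle θ j)) (γ (t j)))
      (Finset.mem_univ i), Function.update_self] at h
  have hrest : ∑ j ∈ Finset.univ.erase i,
      inner ℝ (unitVec (legAngle θ j)) (γ (Function.update t i s j)) =
      ∑ j ∈ Finset.univ.erase i, inner ℝ (unitVec (legAngle θ j)) (γ (t j)) :=
    Finset.sum_congr rfl fun j hj => by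
      rw [Function.update_of_ne (Finset.ne_of_mem_erase hj)]
  rw [hrest] at h
  exact le_of_add_le_add_right h

/-- The sum is the `θ`-derivative of `tripodHeight`, as each leg turns at unit speed. -/
theorem sum_inner_unitVecRot_eq_zero_of_forall_le {γ : ℝ → Plane} {t : Fin 3 → ℝ} {θ : ℝ}
    (hmax : ∀ θ', tripodHeight γ t θ' ≤ tripodHeight γ t θ) :
    ∑ i, inner ℝ (unitVecRot (legAngle θ i)) (γ (t i)) = 0 := by
  refine IsLocalMax.hasDerivAt_eq_zero (f := tripodHeight γ t) (a := θ)
    (Filter.Eventually.of_forall hmax) ?_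
  refine HasDerivAt.fun_sum fun i _ => ?_
  have hleg : HasDerivAt (fun θ' => unitVec (legAngle θ' i)) (unitVecRot (legAngle θ i)) θ :=
    (hasDerivAt_unitVec _).comp_add_const θ _
  simpa using hleg.inner ℝ (hasDerivAt_const θ (γ (t i)))

theorem corollary4p3 (γ : ℝ → Plane) (L : ℝ) (hγ : IsC2ClosedCurve γ L) :
    ∃ (ℓ : Fin 3 → AffineSubspace ℝ Plane) (p : Plane), IsTripodConfiguration γ ℓ p := by
  have hd : Differentiable ℝ γ := hγ.contDiff.differentiable (by norm_num)
  obtain ⟨t, θ, hmax⟩ :=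
    exists_forall_tripodHeight_le hγ.period_pos hγ.periodic hd.continuous
  have horth := inner_deriv_eq_zero_of_forall_le hd fun t' => hmax t' θ
  obtain ⟨p, hp⟩ := exists_inner_unitVecRot_eq θ _
    (sum_inner_unitVecRot_eq_zero_of_forall_le fun θ' => hmax t θ')
  refine ⟨fun i => normalLine γ (t i), p, fun i => ⟨t i, rfl⟩, fun i => ?_,
    fun i => unitVec (legAngle θ i), fun i => ?_, fun i j => angle_unitVec_legAngle θ⟩
  · simp only [normalLine]
    -- The tangent is a multiple of `unitVecRot`, along which `p` and `γ (t i)` have equal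
    -- components.
    rw [AffineSubspace.mem_mk', Submodule.mem_orthogonal_singleton_iff_inner_right,
      eq_smul_unitVecRot (horth i), real_inner_smul_left, vsub_eq_sub, inner_sub_right, hp i,
      sub_self, mul_zero]
  · simp only [normalLine]
    rw [AffineSubspace.direction_mk',
      Submodule.mem_orthogonal_singleton_iff_inner_right, real_inner_comm]
    exact horth i
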